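/- Let $FA=GF_2\langle a_1,\dots,a_k\rangle$ be the free associative algebra over the field with two elements and let $\deg$ denote the degree. For $u\in FA$, $u\neq 0$, whose top homogeneous part is a monomial, that monomial is called the top monomial of $u$. A monomial (a word in $a_1,\dots,a_k$) has no periodicity if it has no subword of the form $\alpha\alpha$ with $\alpha$ a non-empty word. Let $u_1,u_2,u_3,v_1,v_2,v_3\in FA$ satisfy $u_1\ne v_1$, $\deg u_1=\deg v_1$, $\deg u_2>\deg v_2$, $\deg v_3>\deg u_3$, and suppose that the top homogeneous parts of all the $u_i$ and $v_i$ are monomials with no periodicity. Suppose that the equation $$u_1xu_2xu_3=v_1xv_2xv_3\qquad(*)$$ has a solution $x_1\in FA$ with $\deg x_1>2\,(\deg u_1+\deg u_2+(\deg u_3)^2)$ such that all the periodicity in the top monomial $w$ of the two (equal) sides of $(*)$ at $x=x_1$ is contained in the periodicity of the top monomial $y$ of $x_1$ (the top homogeneous part of $x_1$ is necessarily a monomial here), in the following sense: each occurrence of a subword $\alpha\alpha$ of $w$, with $\alpha$ non-empty, lies inside a subword $z$ of $w$ that contains a copy of $y$ and has a period $p>0$ with $2p\le \deg x_1$ (letters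 of $z$ at distance $p$ are equal). Then there exist $s,t\in FA$ such that one of the following holds: (A) there are $\mu_1,\mu_2,s_2,t_2\in FA$ with $u_1=\mu_1(s+1)$, $v_1=\mu_1 s$, $v_2=(t+1)\mu_2$, $u_2=t\mu_2s_2$, $v_3=t_2u_3$, where $(s_2,t_2)$ is $(s,t)$ or $(s+1,t+1)$; (B) there are $\mu_1,\mu_2,s_2,t_2\in FA$ with $u_1=\mu_1 s$, $v_1=\mu_1(s+1)$, $u_2=(t+1)\mu_2$, $v_2s_2=t\mu_2$, $v_3=t_2u_3$, where $(s_2,t_2)$ is $(s,t)$ or $(s+1,t+1)$; and moreover, for the same $s,t$: every solution $x\in FA$ of $sx=xt$ is a solution of $(*)$, and every solution $x_2$ of $(*)$ with $$\deg x_2>2\,\bigl(2+2^{\deg s+2}+\deg u_1+\deg u_2+\deg u_3\bigr)$$ is a solution of $sx=xt$. -/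

import Mathlib

namespace MonomialEq

/-- The free associative algebra `FA = GF₂⟨a₁, …, a_k⟩`. -/
abbrev FA (k : ℕ) : Type := FreeAlgebra (ZMod 2) (Fin k)

variable {k : ℕ}

/-- The finite set of monomials (words in the generators) that occur in `f`,
that is, those that have coefficient `1`. -/
noncomputable def monomials (f : FA k) : Finset (FreeMonoid (Fin k)) :=
  (FreeAlgebra.equivMonoidAlgebraFreeMonoid f).coeff.support

/-- The degree of `f`: the largest length of a monomial of `f` (and `0` for `f = 0`). -/
noncomputable def deg (f : FA k) : ℕ :=
  (monomials f).sup fun m => m.toList.length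

/-- The top homogeneous part of `f` is the monomial `m`: the word `m` occurs in `f` and every
other word that occurs in `f` is strictly shorter. In particular `f ≠ 0`. -/
def IsTopMonomial (f : FA k) (m : FreeMonoid (Fin k)) : Prop :=
  m ∈ monomials f ∧ ∀ w ∈ monomials f, w ≠ m → w.toList.length < m.toList.length

/-- The word `w` has no (non-trivial) periodicity: it contains no subword `αα` with `α`
non-empty. -/
def NoPeriodicity (w : FreeMonoid (Fin k)) : Prop :=
  ∀ a α b : FreeMonoid (Fin k), w = a * α * α * b → α = 1

/-- The top homogeneous part of `f` is a monomial with no periodicity. -/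
def AperiodicTop (f : FA k) : Prop :=
  ∃ m, IsTopMonomial f m ∧ NoPeriodicity m

/-- `p` is a period of the word `z`: letters of `z` at distance `p` are equal. -/
def HasPeriod (z : FreeMonoid (Fin k)) (p : ℕ) : Prop :=
  ∀ i, i + p < z.toList.length → z.toList[i]? = z.toList[i + p]?

/-- All the periodicity of the word `w` is contained in the periodicity of its subword `y`:
each occurrence `w = a α α b` of a non-empty square in `w` lies inside a subword
`z` of `w` (`w = a' z b'` with `a'` no longer than `a` and `b'` no longer than `b`) that contains
`y` and continues a periodicity of `y`, that is, `z` has a period `p > 0` that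
fits at least twice into `y`. -/
def PeriodicityContainedIn (w y : FreeMonoid (Fin k)) : Prop :=
  ∀ a α b : FreeMonoid (Fin k), w = a * α * α * b → α ≠ 1 →
    ∃ a' z b' : FreeMonoid (Fin k), w = a' * z * b' ∧
      a'.toList.length ≤ a.toList.length ∧ b'.toList.length ≤ b.toList.length ∧
      (∃ c d : FreeMonoid (Fin k), z = c * y * d) ∧
      ∃ p, 0 < p ∧ 2 * p ≤ y.toList.length ∧ HasPeriod z p

end MonomialEq

/-! Capitals denote top words. Comparing longest words on both sides shows that the top of x is one
word y, and U₁ = V₁, U₂ = V₂β, V₃ = γU₃, βy = yγ. With r = u₁ + v₁, characteristic 2 turns the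
equation into v₁xC = r x u₂ x u₃, where C = u₂xu₃ + v₂xv₃. Since x is long, short periods of y
commute, and commuting non-empty square-free words coincide; hence V₁ = Rβ. A non-zero remainder of
v₁ modulo r would put a square into V₁, so v₁ = rq; likewise v₃ = t₂u₃.

Cancelling r and u₃ leaves qx(u₂x + v₂xt₂) = xu₂x. The factors x are now peeled off by
`exists_eq_mul_right_of_mul_eq_mul` and its mirror image: a non-zero remainder would have a single
top word, hence a non-zero image of too small a degree when all generators are sent to X, where
divisibility by x is evident. This yields qx = xp, u₂ = pE and s₂x = xt₂. As q and s₂ share the top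
word β, they differ by a constant, and s = q + 1, t = p + 1 give alternative (B).

Solutions of sx = xt solve the equation by substitution. Conversely, for a solution x with z = xt −
sx ≠ 0 the equation reduces to zμ₂x = (s + 1)xv₂z, and lengths would force t to be constant. -/

namespace MonomialEq

open Polynomial

/-! ### Equidivisibility of words -/

section Words

variable {α : Type*}

/-- Equidivisibility of the free monoid. -/
lemma exists_eq_mul_of_mul_eq_mul {a b c d : FreeMonoid α} (h : a * b = c * d)
    (hl : a.length ≤ c.length) : ∃ e, c = a * e ∧ b = e * d := by
  rcases List.append_eq_append_iff.1 (show a.toList ++ b.toList = c.toList ++ d.toList from h) with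
    ⟨e, h1, h2⟩ | ⟨e, h1, h2⟩
  · exact ⟨FreeMonoid.ofList e, h1, h2⟩
  · have h3 : a.length = c.length + e.length :=
      (congrArg List.length h1).trans List.length_append
    have h4 : e = [] := List.length_eq_zero_iff.1 (by omega)
    subst h4
    refine ⟨1, ?_, ?_⟩
    · rw [mul_one]
      exact ((List.append_nil c.toList).symm.trans h1.symm)
    · rw [one_mul]
      exact h2.symm

lemma eq_and_eq_of_mul_eq_mul {a b c d : FreeMonoid α} (h : a * b = c * d)
    (hl : a.length = c.length) : a = c ∧ b = d := by
  obtain ⟨e, rfl, rfl⟩ := exists_eq_mul_of_mul_eq_mul h hl.le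
  have : e = 1 := FreeMonoid.length_eq_zero.1 (by rw [FreeMonoid.length_mul] at hl; omega)
  subst this
  simp

lemma eq_and_eq_of_mul_eq_mul_right {a b c d : FreeMonoid α} (h : a * b = c * d)
    (hl : b.length = d.length) : a = c ∧ b = d := by
  refine eq_and_eq_of_mul_eq_mul h ?_
  have := congrArg FreeMonoid.length h
  simp only [FreeMonoid.length_mul] at this
  omega

lemma length_pos_of_ne_one {a : FreeMonoid α} (h : a ≠ 1) : 0 < a.length :=
  Nat.pos_of_ne_zero fun h0 => h (FreeMonoid.length_eq_zero.1 h0)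

end Words

/-! ### Square-free words and periods -/

variable {k : ℕ}

lemma NoPeriodicity.factor {a w b : FreeMonoid (Fin k)} (h : NoPeriodicity (a * w * b)) :
    NoPeriodicity w := by
  rintro a' α b' rfl
  exact h (a * a') α (b' * b) (by simp only [mul_assoc])

lemma NoPeriodicity.of_mul_left {a w : FreeMonoid (Fin k)} (h : NoPeriodicity (a * w)) :
    NoPeriodicity w :=
  NoPeriodicity.factor (a := a) (b := 1) (by simpa using h)

lemma NoPeriodicity.of_mul_right {w b : FreeMonoid (Fin k)} (h : NoPeriodicity (w * b)) :
    NoPeriodicity w :=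
  NoPeriodicity.factor (a := 1) (b := b) (by simpa using h)

/-- A non-empty prefix `θ` of a word `y` with `β y = y γ`, followed by `β`, contains a square. -/
lemma not_noPeriodicity_prefix_mul {β γ y : FreeMonoid (Fin k)} (hβ : β ≠ 1)
    (hy : β * y = y * γ) :
    ∀ {θ z : FreeMonoid (Fin k)}, y = θ * z → θ ≠ 1 → ¬ NoPeriodicity (θ * β) := by
  suffices H : ∀ n, ∀ θ z : FreeMonoid (Fin k), θ.length = n → y = θ * z → θ ≠ 1 →
      ¬ NoPeriodicity (θ * β) from fun {θ z} => H _ θ z rfl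
  intro n
  induction n using Nat.strong_induction_on with
  | _ n ih =>
    intro θ z hn hz hθ hsq
    -- A short θ is a prefix of β, so θβ begins with θθ. A longer one is βe with e again a prefix of
    -- y, and the induction applies to eβ.
    rcases le_or_gt θ.length β.length with hl | hl
    · have h1 : θ * (z * γ) = β * y := by rw [hy, hz, mul_assoc]
      obtain ⟨e, he, -⟩ := exists_eq_mul_of_mul_eq_mul h1 hl
      exact hθ (hsq 1 θ e (by rw [he]; simp only [one_mul, mul_assoc]))
    · have h1 : β * y = θ * (z * γ) := by rw [hy, hz, mul_assoc]
      obtain ⟨e, he, he'⟩ := exists_eq_mul_of_mul_eq_mul h1 hl.le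
      have hlen : θ.length = β.length + e.length := by rw [he, FreeMonoid.length_mul]
      have hβ' := length_pos_of_ne_one hβ
      refine ih e.length (by omega) e (z * γ) rfl he' ?_ ?_
      · rintro rfl
        simp at hlen
        omega
      · rw [he, mul_assoc] at hsq
        exact hsq.of_mul_left

/-- A non-empty suffix `θ` of a word `y` with `β y = y γ`, preceded by `γ`, contains a square. -/
lemma not_noPeriodicity_mul_suffix {β γ y : FreeMonoid (Fin k)} (hγ : γ ≠ 1)
    (hy : β * y = y * γ) :
    ∀ {θ z : FreeMonoid (Fin k)}, y = z * θ → θ ≠ 1 → ¬ NoPeriodicity (γ * θ) := by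
  suffices H : ∀ n, ∀ θ z : FreeMonoid (Fin k), θ.length = n → y = z * θ → θ ≠ 1 →
      ¬ NoPeriodicity (γ * θ) from fun {θ z} => H _ θ z rfl
  intro n
  induction n using Nat.strong_induction_on with
  | _ n ih =>
    intro θ z hn hz hθ hsq
    have h1 : y * γ = (β * z) * θ := by rw [← hy, hz, mul_assoc]
    have hlen := congrArg FreeMonoid.length h1
    rw [FreeMonoid.length_mul, FreeMonoid.length_mul (β * z)] at hlen
    rcases le_or_gt θ.length γ.length with hl | hl
    · obtain ⟨e, -, he⟩ := exists_eq_mul_of_mul_eq_mul h1 (by omega)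
      exact hθ (hsq e θ 1 (by rw [he]; simp only [mul_one]))
    · obtain ⟨e, he, he'⟩ := exists_eq_mul_of_mul_eq_mul h1.symm (by omega)
      have hlen : θ.length = e.length + γ.length := by rw [he', FreeMonoid.length_mul]
      have hγ' := length_pos_of_ne_one hγ
      refine ih e.length (by omega) e (β * z) rfl he ?_ ?_
      · rintro rfl
        simp at hlen
        omega
      · rw [he', ← mul_assoc] at hsq
        exact hsq.of_mul_right

/-- Commuting non-empty square-free words are equal. -/
lemma eq_of_mul_comm_of_noPeriodicity {a b : FreeMonoid (Fin k)} (h : a * b = b * a)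
    (ha : a ≠ 1) (hb : b ≠ 1) (hsa : NoPeriodicity a) (hsb : NoPeriodicity b) : a = b := by
  suffices H : ∀ n, ∀ a b : FreeMonoid (Fin k), a.length + b.length = n → a * b = b * a →
      a ≠ 1 → b ≠ 1 → NoPeriodicity a → NoPeriodicity b → a = b from
    H _ a b rfl h ha hb hsa hsb
  clear h ha hb hsa hsb a b
  intro n
  induction n using Nat.strong_induction_on with
  | _ n ih =>
    have key : ∀ a b : FreeMonoid (Fin k), a.length ≤ b.length → a.length + b.length = n →
        a * b = b * a → a ≠ 1 → b ≠ 1 → NoPeriodicity a → NoPeriodicity b → a = b := by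
      intro a b hl hn h ha hb hsa hsb
      -- Euclidean subtraction: b = ae and e commutes with a. If e ≠ 1, induction gives e = a, and b
      -- = aa is a square.
      obtain ⟨e, rfl, he⟩ := exists_eq_mul_of_mul_eq_mul h hl
      by_cases h1 : e = 1
      · simp [h1]
      · have hpos := length_pos_of_ne_one ha
        rw [FreeMonoid.length_mul] at hn
        have := ih (a.length + e.length) (by omega) a e rfl he ha h1 hsa hsb.of_mul_left
        subst this
        exact absurd (hsb 1 a 1 (by simp)) ha
    intro a b hn h ha hb hsa hsb
    rcases le_total a.length b.length with hl | hl
    · exact key a b hl hn h ha hb hsa hsb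
    · exact (key b a hl (by omega) h.symm hb ha hsb hsa).symm

/-- Two periods of a word `y`, whose lengths fit into `y` together, commute. -/
lemma mul_comm_of_periods {a b y c d g : FreeMonoid (Fin k)} (ha : a * y * c = y * g)
    (hb : b * y = y * d) (hl : a.length + b.length ≤ y.length) : a * b = b * a := by
  -- Both ab and ba turn out to be prefixes of y, of the same length.
  obtain ⟨y₁, h1, h1'⟩ := exists_eq_mul_of_mul_eq_mul (a := a) (b := y * c) (c := y) (d := g)
    (by rw [← mul_assoc, ha]) (by omega)
  obtain ⟨y₂, h2, h2'⟩ := exists_eq_mul_of_mul_eq_mul hb (by omega)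
  have l1 := congrArg FreeMonoid.length h1
  have l2 := congrArg FreeMonoid.length h2
  rw [FreeMonoid.length_mul] at l1 l2
  obtain ⟨e, he, -⟩ := exists_eq_mul_of_mul_eq_mul h1'.symm (by omega)
  obtain ⟨f, hf, -⟩ := exists_eq_mul_of_mul_eq_mul (h2.symm.trans he) (by omega)
  obtain ⟨f', hf', -⟩ := exists_eq_mul_of_mul_eq_mul (h1.symm.trans h2') (by omega)
  refine (eq_and_eq_of_mul_eq_mul (b := f) (d := f') ?_ ?_).1
  · rw [mul_assoc, mul_assoc, ← hf, ← hf', ← h1, ← h2]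
  · simp only [FreeMonoid.length_mul]
    omega

/-! ### Longest and leading words in the monoid algebra -/

section Algebra

/-- The monoid algebra model of the free associative algebra. -/
abbrev WordAlgebra (k : ℕ) : Type := MonoidAlgebra (ZMod 2) (FreeMonoid (Fin k))

instance : NoZeroDivisors (WordAlgebra k) :=
  (FreeAlgebra.equivMonoidAlgebraFreeMonoid (R := ZMod 2)
    (X := Fin k)).symm.toMulEquiv.noZeroDivisors

instance : CharP (WordAlgebra k) 2 :=
  charP_of_injective_algebraMap (algebraMap (ZMod 2) (WordAlgebra k)).injective 2

/-- `m` is a longest word occurring in `f`. -/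
def IsLongest (f : WordAlgebra k) (m : FreeMonoid (Fin k)) : Prop :=
  f.coeff m ≠ 0 ∧ ∀ w, f.coeff w ≠ 0 → w.length ≤ m.length

/-- `m` is the only longest word occurring in `f`. -/
def IsLeading (f : WordAlgebra k) (m : FreeMonoid (Fin k)) : Prop :=
  IsLongest f m ∧ ∀ w, IsLongest f w → w = m

variable {f g h x : WordAlgebra k} {a b m w y : FreeMonoid (Fin k)}

lemma IsLongest.length_eq (ha : IsLongest f a) (hb : IsLongest f b) : a.length = b.length :=
  le_antisymm (hb.2 _ ha.1) (ha.2 _ hb.1)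

lemma IsLongest.ne_zero (ha : IsLongest f a) : f ≠ 0 := by
  rintro rfl
  exact ha.1 (by simp)

lemma exists_isLongest (hf : f ≠ 0) : ∃ m, IsLongest f m := by
  have : f.coeff.support.Nonempty := by
    rw [Finsupp.support_nonempty_iff]
    simpa using hf
  obtain ⟨m, hm, hmax⟩ := f.coeff.support.exists_max_image FreeMonoid.length this
  exact ⟨m, by simpa using hm, fun w hw => hmax w (by simpa using hw)⟩

lemma exists_of_coeff_mul_ne_zero (hm : (f * g).coeff m ≠ 0) :
    ∃ a b, f.coeff a ≠ 0 ∧ g.coeff b ≠ 0 ∧ m = a * b := by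
  classical
  have := MonoidAlgebra.support_coeff_mul_subset f g (Finsupp.mem_support_iff.2 hm)
  obtain ⟨a, ha, b, hb, rfl⟩ := Finset.mem_mul.1 this
  exact ⟨a, b, by simpa using ha, by simpa using hb, rfl⟩

/-- No cancellation occurs: by length, a and b are the only words of f and g whose product is ab. -/
lemma IsLongest.mul (ha : IsLongest f a) (hb : IsLongest g b) : IsLongest (f * g) (a * b) := by
  classical
  refine ⟨?_, ?_⟩
  · rw [MonoidAlgebra.coeff_mul, Finsupp.sum, Finset.sum_eq_single a, Finsupp.sum,
      Finset.sum_eq_single b]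
    · simpa using ⟨ha.1, hb.1⟩
    · intro c _ hc
      rw [if_neg]
      exact fun h => hc (mul_left_cancel h)
    · intro hb'
      exact absurd hb.1 (by simpa using hb')
    · intro c hc hca
      refine Finset.sum_eq_zero fun d hd => ?_
      refine if_neg fun h => ?_
      have h1 := ha.2 c (by simpa using hc)
      have h2 := hb.2 d (by simpa using hd)
      have h3 := congrArg FreeMonoid.length h
      simp only [FreeMonoid.length_mul] at h3
      exact hca (eq_and_eq_of_mul_eq_mul h (by omega)).1
    · intro ha'
      exact absurd ha.1 (by simpa using ha')
  · intro w hw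
    obtain ⟨c, d, hc, hd, rfl⟩ := exists_of_coeff_mul_ne_zero hw
    have h1 := ha.2 c hc
    have h2 := hb.2 d hd
    simp only [FreeMonoid.length_mul]
    omega

lemma IsLongest.exists_of_mul (hm : IsLongest (f * g) m) :
    ∃ a b, IsLongest f a ∧ IsLongest g b ∧ m = a * b := by
  obtain ⟨a, ha⟩ := exists_isLongest (left_ne_zero_of_mul hm.ne_zero)
  obtain ⟨b, hb⟩ := exists_isLongest (right_ne_zero_of_mul hm.ne_zero)
  obtain ⟨c, d, hc, hd, rfl⟩ := exists_of_coeff_mul_ne_zero hm.1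
  have h1 := ha.2 c hc
  have h2 := hb.2 d hd
  have h3 := hm.length_eq (ha.mul hb)
  simp only [FreeMonoid.length_mul] at h3
  exact ⟨c, d, ⟨hc, fun w hw => (ha.2 w hw).trans (by omega)⟩,
    ⟨hd, fun w hw => (hb.2 w hw).trans (by omega)⟩, rfl⟩

lemma IsLeading.ne_zero (h : IsLeading f m) : f ≠ 0 := h.1.ne_zero

lemma coeff_eq_one_of_ne_zero (h : f.coeff m ≠ 0) : f.coeff m = 1 := by
  generalize f.coeff m = c at h
  revert c
  decide

/-- Adding `1` keeps the longest words that are not empty. -/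
lemma IsLongest.add_one (hm : IsLongest f m) (h1 : m ≠ 1) : IsLongest (f + 1) m := by
  have hone : ∀ w : FreeMonoid (Fin k), w ≠ 1 → (1 : WordAlgebra k).coeff w = 0 := by
    intro w hw
    rw [MonoidAlgebra.one_def, MonoidAlgebra.coeff_single, Finsupp.single_eq_of_ne hw]
  refine ⟨?_, fun w hw => ?_⟩
  · rw [MonoidAlgebra.coeff_add, Finsupp.add_apply, hone m h1, add_zero]
    exact hm.1
  · by_cases hw1 : w = 1
    · simp [hw1]
    · rw [MonoidAlgebra.coeff_add, Finsupp.add_apply, hone w hw1, add_zero] at hw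
      exact hm.2 w hw

/-- The sum of two elements with the same leading word has only shorter words. -/
lemma IsLeading.length_lt_of_add (hf : IsLeading f m) (hg : IsLeading g m)
    (hw : (f + g).coeff w ≠ 0) : w.length < m.length := by
  rw [MonoidAlgebra.coeff_add, Finsupp.add_apply] at hw
  have hle : w.length ≤ m.length := by
    by_cases h : f.coeff w = 0
    · rw [h, zero_add] at hw
      exact hg.1.2 w hw
    · exact hf.1.2 w h
  refine lt_of_le_of_ne hle fun heq => ?_
  have hlong : ∀ {p : WordAlgebra k}, IsLeading p m → p.coeff w ≠ 0 → w = m := fun hp hw' =>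
    hp.2 w ⟨hw', fun v hv => (hp.1.2 v hv).trans heq.ge⟩
  by_cases h : w = m
  · subst h
    rw [coeff_eq_one_of_ne_zero hf.1.1, coeff_eq_one_of_ne_zero hg.1.1] at hw
    exact hw (by decide)
  · rw [not_not.1 fun h' => h (hlong hf h'), not_not.1 fun h' => h (hlong hg h')] at hw
    exact hw (by decide)

/-! ### Specialization to one variable -/

/-- The specialization of all generators to one variable. -/
noncomputable def specialize : WordAlgebra k →ₐ[ZMod 2] (ZMod 2)[X] :=
  MonoidAlgebra.lift (ZMod 2) (ZMod 2)[X] (FreeMonoid (Fin k)) (FreeMonoid.lift fun _ => X)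

lemma specialize_single (m : FreeMonoid (Fin k)) (r : ZMod 2) :
    specialize (MonoidAlgebra.single m r) = C r * X ^ m.length := by
  have : FreeMonoid.lift (fun _ : Fin k => (X : (ZMod 2)[X])) m = X ^ m.length := by
    induction m using FreeMonoid.inductionOn' with
    | one => simp
    | of_mul a m ih => rw [map_mul, ih, FreeMonoid.length_mul]; simp [pow_add]
  rw [specialize, MonoidAlgebra.lift_single, this, Algebra.smul_def]
  rfl

lemma coeff_specialize (f : WordAlgebra k) (n : ℕ) :
    (specialize f).coeff n = f.coeff.sum fun m r => if n = m.length then r else 0 := by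
  conv_lhs => rw [← MonoidAlgebra.sum_coeff_single f]
  rw [Finsupp.sum, map_sum, Polynomial.finsetSum_coeff, Finsupp.sum]
  refine Finset.sum_congr rfl fun m _ => ?_
  rw [specialize_single, Polynomial.coeff_C_mul_X_pow]

/-- Specialization merges words of equal length; a leading word is alone in its length, so it
survives. -/
lemma IsLeading.specialize_coeff_length (hf : IsLeading f m) :
    (specialize f).coeff m.length ≠ 0 := by
  rw [coeff_specialize, Finsupp.sum, Finset.sum_eq_single m]
  · simpa using hf.1.1
  · intro w hw hwm
    rw [if_neg]
    intro h
    exact hwm (hf.2 w ⟨by simpa using hw, fun v hv => (hf.1.2 v hv).trans h.le⟩)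
  · intro hm
    exact absurd hf.1.1 (by simpa using hm)

lemma IsLeading.natDegree_specialize (hf : IsLeading f m) :
    (specialize f).natDegree = m.length := by
  refine le_antisymm ?_ (Polynomial.le_natDegree_of_ne_zero hf.specialize_coeff_length)
  rw [Polynomial.natDegree_le_iff_coeff_eq_zero]
  intro n hn
  rw [coeff_specialize, Finsupp.sum]
  refine Finset.sum_eq_zero fun w hw => if_neg fun h => ?_
  have := hf.1.2 w (by simpa using hw)
  omega

lemma IsLeading.specialize_ne_zero (hf : IsLeading f m) : specialize f ≠ 0 := fun h =>
  hf.specialize_coeff_length (by simp [h])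

lemma IsLeading.mul (hf : IsLeading f a) (hg : IsLeading g b) : IsLeading (f * g) (a * b) := by
  refine ⟨hf.1.mul hg.1, fun w hw => ?_⟩
  obtain ⟨c, d, hc, hd, rfl⟩ := hw.exists_of_mul
  rw [hf.2 c hc, hg.2 d hd]

lemma eq_of_coeff_single_ne_zero
    (hw : (MonoidAlgebra.single m 1 : WordAlgebra k).coeff w ≠ 0) : w = m := by
  by_contra hwm
  rw [MonoidAlgebra.coeff_single, Finsupp.single_eq_of_ne hwm] at hw
  exact hw rfl

lemma isLeading_single (m : FreeMonoid (Fin k)) :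
    IsLeading (MonoidAlgebra.single m 1 : WordAlgebra k) m := by
  refine ⟨⟨by simp, fun w hw => by rw [eq_of_coeff_single_ne_zero hw]⟩, fun w hw =>
    eq_of_coeff_single_ne_zero hw.1⟩

/-! ### Division with remainder and divisibility -/

/-- A property closed under addition holds for `f` when it holds for the words of `f`. -/
lemma induction_words {P : WordAlgebra k → Prop} (hadd : ∀ f g, P f → P g → P (f + g))
    (hzero : P 0) (f : WordAlgebra k)
    (hf : ∀ w, f.coeff w ≠ 0 → P (MonoidAlgebra.single w 1)) : P f := by
  rw [← MonoidAlgebra.sum_coeff_single f, Finsupp.sum]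
  refine Finset.sum_induction _ P hadd hzero fun w hw => ?_
  have hw : f.coeff w ≠ 0 := by simpa using hw
  rw [coeff_eq_one_of_ne_zero hw]
  exact hf w hw

/-- Division with remainder on the right by an element with a leading word. -/
lemma exists_eq_mul_add_right (hx : IsLeading x y) (f : WordAlgebra k) :
    ∃ q ρ : WordAlgebra k, f = q * x + ρ ∧ ∀ w, ρ.coeff (w * y) = 0 := by
  set P : WordAlgebra k → Prop := fun f =>
    ∃ q ρ : WordAlgebra k, f = q * x + ρ ∧ ∀ w, ρ.coeff (w * y) = 0 with hP
  have hadd : ∀ f g, P f → P g → P (f + g) := by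
    rintro _ _ ⟨q, ρ, rfl, h⟩ ⟨q', ρ', rfl, h'⟩
    exact ⟨q + q', ρ + ρ', by rw [add_mul]; abel, fun w => by
      rw [MonoidAlgebra.coeff_add, Finsupp.add_apply, h, h', add_zero]⟩
  have hzero : P 0 := ⟨0, 0, by simp, by simp⟩
  suffices H : ∀ n, ∀ m : FreeMonoid (Fin k), m.length = n → P (MonoidAlgebra.single m 1) from
    induction_words hadd hzero f fun w _ => H _ w rfl
  intro n
  induction n using Nat.strong_induction_on with
  | _ n ih =>
    intro m hm
    by_cases hmy : ∃ a, m = a * y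
    · obtain ⟨a, rfl⟩ := hmy
      have h1 := (isLeading_single a).mul hx
      -- The word ay is also the leading word of ax, so the sum has only shorter words.
      have h2 : P (MonoidAlgebra.single (a * y) 1 + MonoidAlgebra.single a 1 * x) :=
        induction_words hadd hzero _ fun w hw =>
          ih w.length (hm ▸ (isLeading_single (a * y)).length_lt_of_add h1 hw) w rfl
      have h3 : P (MonoidAlgebra.single a 1 * x) := ⟨MonoidAlgebra.single a 1, 0, by simp, by simp⟩
      have h4 := hadd _ _ h2 h3
      rwa [add_assoc, CharTwo.add_self_eq_zero, add_zero] at h4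
    · refine ⟨0, MonoidAlgebra.single m 1, by simp, fun w => ?_⟩
      by_contra hw
      exact hmy ⟨w, (eq_of_coeff_single_ne_zero hw).symm⟩

/-- Division with remainder on the left by an element with a leading word. -/
lemma exists_eq_mul_add_left (hx : IsLeading x y) (f : WordAlgebra k) :
    ∃ q ρ : WordAlgebra k, f = x * q + ρ ∧ ∀ w, ρ.coeff (y * w) = 0 := by
  set P : WordAlgebra k → Prop := fun f =>
    ∃ q ρ : WordAlgebra k, f = x * q + ρ ∧ ∀ w, ρ.coeff (y * w) = 0 with hP
  have hadd : ∀ f g, P f → P g → P (f + g) := by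
    rintro _ _ ⟨q, ρ, rfl, h⟩ ⟨q', ρ', rfl, h'⟩
    exact ⟨q + q', ρ + ρ', by rw [mul_add]; abel, fun w => by
      rw [MonoidAlgebra.coeff_add, Finsupp.add_apply, h, h', add_zero]⟩
  have hzero : P 0 := ⟨0, 0, by simp, by simp⟩
  suffices H : ∀ n, ∀ m : FreeMonoid (Fin k), m.length = n → P (MonoidAlgebra.single m 1) from
    induction_words hadd hzero f fun w _ => H _ w rfl
  intro n
  induction n using Nat.strong_induction_on with
  | _ n ih =>
    intro m hm
    by_cases hmy : ∃ a, m = y * a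
    · obtain ⟨a, rfl⟩ := hmy
      have h1 := hx.mul (isLeading_single a)
      have h2 : P (MonoidAlgebra.single (y * a) 1 + x * MonoidAlgebra.single a 1) :=
        induction_words hadd hzero _ fun w hw =>
          ih w.length (hm ▸ (isLeading_single (y * a)).length_lt_of_add h1 hw) w rfl
      have h3 : P (x * MonoidAlgebra.single a 1) := ⟨MonoidAlgebra.single a 1, 0, by simp, by simp⟩
      have h4 := hadd _ _ h2 h3
      rwa [add_assoc, CharTwo.add_self_eq_zero, add_zero] at h4
    · refine ⟨0, MonoidAlgebra.single m 1, by simp, fun w => ?_⟩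
      by_contra hw
      exact hmy ⟨w, (eq_of_coeff_single_ne_zero hw).symm⟩

/-- If a left multiple `g f` of `f` is right divisible by `x`, and the specialization of `x`
divides that of `f`, then `f` is itself right divisible by `x`. -/
lemma exists_eq_mul_right_of_mul_eq_mul (hx : IsLeading x y) (hg : g ≠ 0)
    (hfg : g * f = h * x) (hdvd : specialize x ∣ specialize f) : ∃ q, f = q * x := by
  obtain ⟨q, ρ, hq, hρ⟩ := exists_eq_mul_add_right hx f
  by_cases hρ0 : ρ = 0
  · exact ⟨q, by rw [hq, hρ0, add_zero]⟩
  exfalso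
  obtain ⟨c, hc⟩ := exists_isLongest hg
  obtain ⟨w₀, hw₀⟩ := exists_isLongest hρ0
  have hmul : g * ρ = (h + g * q) * x := by
    rw [add_mul, ← hfg, hq, mul_add, mul_assoc]
    rw [add_right_comm, CharTwo.add_self_eq_zero, zero_add]
  -- A product cw is a longest word of a left multiple of x, so it ends in y. The word w cannot
  -- itself end in y, hence is a proper suffix of y.
  have key : ∀ w, IsLongest ρ w → w.length < y.length ∧ ∃ e, y = e * w := by
    intro w hw
    have h1 := hc.mul hw
    rw [hmul] at h1
    obtain ⟨d, y', -, hy', h2⟩ := h1.exists_of_mul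
    rw [hx.2 y' hy'] at h2
    have hlen := congrArg FreeMonoid.length h2
    simp only [FreeMonoid.length_mul] at hlen
    rcases lt_or_ge w.length y.length with hl | hl
    · obtain ⟨e, -, he⟩ := exists_eq_mul_of_mul_eq_mul h2.symm (by omega)
      exact ⟨hl, e, he⟩
    · obtain ⟨e, -, he⟩ := exists_eq_mul_of_mul_eq_mul h2 (by omega)
      exact absurd (he ▸ hρ e) hw.1
  obtain ⟨hl, e, he⟩ := key w₀ hw₀
  have hlead : IsLeading ρ w₀ := by
    refine ⟨hw₀, fun w hw => ?_⟩
    obtain ⟨-, e', he'⟩ := key w hw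
    exact (eq_and_eq_of_mul_eq_mul_right (he'.symm.trans he) (hw.length_eq hw₀)).2
  -- The image of ρ is divisible by that of x but has smaller degree, which contradicts the survival
  -- of its leading word.
  refine hlead.specialize_ne_zero (Polynomial.eq_zero_of_dvd_of_natDegree_lt (p := specialize x)
    ?_ ?_)
  · have h1 : specialize f = specialize q * specialize x + specialize ρ := by
      rw [hq, map_add, map_mul]
    rw [h1] at hdvd
    exact (dvd_add_right (dvd_mul_left _ _)).1 hdvd
  · rwa [hlead.natDegree_specialize, hx.natDegree_specialize]

/-- If a right multiple `f g` of `f` is left divisible by `x`, and the specialization of `x`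
divides that of `f`, then `f` is itself left divisible by `x`. -/
lemma exists_eq_mul_left_of_mul_eq_mul (hx : IsLeading x y) (hg : g ≠ 0)
    (hfg : f * g = x * h) (hdvd : specialize x ∣ specialize f) : ∃ q, f = x * q := by
  obtain ⟨q, ρ, hq, hρ⟩ := exists_eq_mul_add_left hx f
  by_cases hρ0 : ρ = 0
  · exact ⟨q, by rw [hq, hρ0, add_zero]⟩
  exfalso
  obtain ⟨c, hc⟩ := exists_isLongest hg
  obtain ⟨w₀, hw₀⟩ := exists_isLongest hρ0
  have hmul : ρ * g = x * (h + q * g) := by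
    rw [mul_add, ← hfg, hq, add_mul, mul_assoc]
    rw [add_right_comm, CharTwo.add_self_eq_zero, zero_add]
  have key : ∀ w, IsLongest ρ w → w.length < y.length ∧ ∃ e, y = w * e := by
    intro w hw
    have h1 := hw.mul hc
    rw [hmul] at h1
    obtain ⟨y', d, hy', -, h2⟩ := h1.exists_of_mul
    rw [hx.2 y' hy'] at h2
    rcases lt_or_ge w.length y.length with hl | hl
    · obtain ⟨e, he, -⟩ := exists_eq_mul_of_mul_eq_mul h2 hl.le
      exact ⟨hl, e, he⟩
    · obtain ⟨e, he, -⟩ := exists_eq_mul_of_mul_eq_mul h2.symm hl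
      exact absurd (he ▸ hρ e) hw.1
  obtain ⟨hl, e, he⟩ := key w₀ hw₀
  have hlead : IsLeading ρ w₀ := by
    refine ⟨hw₀, fun w hw => ?_⟩
    obtain ⟨-, e', he'⟩ := key w hw
    exact (eq_and_eq_of_mul_eq_mul (he'.symm.trans he) (hw.length_eq hw₀)).1
  refine hlead.specialize_ne_zero (Polynomial.eq_zero_of_dvd_of_natDegree_lt (p := specialize x)
    ?_ ?_)
  · have h1 : specialize f = specialize x * specialize q + specialize ρ := by
      rw [hq, map_add, map_mul]
    rw [h1] at hdvd
    exact (dvd_add_right (dvd_mul_right _ _)).1 hdvd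
  · rwa [hlead.natDegree_specialize, hx.natDegree_specialize]

/-! ### Consequences of the equation -/

variable {u₁ u₂ u₃ v₁ v₂ v₃ r v : WordAlgebra k}
  {U₁ U₂ U₃ V₁ V₂ V₃ R β γ : FreeMonoid (Fin k)}

/-- If the square-free leading word of `v` is `R β` with `R` the leading word of `r` and `β` a
period of the leading word `y` of `x`, then `v x C ∈ r FA` forces `v ∈ r FA`. -/
lemma exists_eq_mul_left_of_noPeriodicity (hr : IsLeading r R) (hx : IsLeading x y)
    (hsq : NoPeriodicity (R * β)) (hβ : β ≠ 1) (hy : β * y = y * γ) (hl : R.length ≤ y.length)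
    (hg : g ≠ 0) (hv : v * (x * g) = r * h) : ∃ q, v = r * q := by
  obtain ⟨q, ρ, hq, hρ⟩ := exists_eq_mul_add_left hr v
  by_cases hρ0 : ρ = 0
  · exact ⟨q, by rw [hq, hρ0, add_zero]⟩
  exfalso
  obtain ⟨c, hc⟩ := exists_isLongest hg
  obtain ⟨w, hw⟩ := exists_isLongest hρ0
  have hmul : ρ * (x * g) = r * (h + q * (x * g)) := by
    rw [mul_add, ← hv, hq, add_mul, mul_assoc]
    rw [add_right_comm, CharTwo.add_self_eq_zero, zero_add]
  have h1 := hw.mul (hx.1.mul hc)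
  rw [hmul] at h1
  obtain ⟨R', d, hR', -, h2⟩ := h1.exists_of_mul
  rw [hr.2 R' hR'] at h2
  rcases le_or_gt R.length w.length with hlw | hlw
  · obtain ⟨e, he, -⟩ := exists_eq_mul_of_mul_eq_mul h2.symm hlw
    exact hw.1 (he ▸ hρ e)
  -- Now R = wθ with θ a non-empty prefix of y, so θβ, a suffix of Rβ, contains a square.
  · obtain ⟨θ, rfl, h3⟩ := exists_eq_mul_of_mul_eq_mul h2 hlw.le
    rw [FreeMonoid.length_mul] at hl hlw
    obtain ⟨z, hz, -⟩ := exists_eq_mul_of_mul_eq_mul h3.symm (by omega)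
    refine not_noPeriodicity_prefix_mul hβ hy hz ?_ (NoPeriodicity.of_mul_left (a := w) ?_)
    · rintro rfl
      simp at hlw
    · rwa [← mul_assoc]

/-- If the square-free leading word of `v` is `γ R` with `R` the leading word of `r` and `γ` a
period of the leading word `y` of `x`, then `C x v ∈ FA r` forces `v ∈ FA r`. -/
lemma exists_eq_mul_right_of_noPeriodicity (hr : IsLeading r R) (hx : IsLeading x y)
    (hsq : NoPeriodicity (γ * R)) (hγ : γ ≠ 1) (hy : β * y = y * γ) (hl : R.length ≤ y.length)
    (hg : g ≠ 0) (hv : g * x * v = h * r) : ∃ q, v = q * r := by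
  obtain ⟨q, ρ, hq, hρ⟩ := exists_eq_mul_add_right hr v
  by_cases hρ0 : ρ = 0
  · exact ⟨q, by rw [hq, hρ0, add_zero]⟩
  exfalso
  obtain ⟨c, hc⟩ := exists_isLongest hg
  obtain ⟨w, hw⟩ := exists_isLongest hρ0
  have hmul : g * x * ρ = (h + g * x * q) * r := by
    rw [add_mul, ← hv, hq, mul_add, mul_assoc (g * x) q r]
    rw [add_right_comm, CharTwo.add_self_eq_zero, zero_add]
  have h1 := (hc.mul hx.1).mul hw
  rw [hmul] at h1
  obtain ⟨d, R', -, hR', h2⟩ := h1.exists_of_mul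
  rw [hr.2 R' hR'] at h2
  have hlen := congrArg FreeMonoid.length h2
  rw [FreeMonoid.length_mul, FreeMonoid.length_mul d] at hlen
  rcases le_or_gt R.length w.length with hlw | hlw
  · obtain ⟨e, -, he⟩ := exists_eq_mul_of_mul_eq_mul h2 (by omega)
    exact hw.1 (he ▸ hρ e)
  · obtain ⟨θ, h3, rfl⟩ := exists_eq_mul_of_mul_eq_mul h2.symm (by omega)
    have hlen := congrArg FreeMonoid.length h3
    simp only [FreeMonoid.length_mul] at hl hlw hlen
    obtain ⟨z, -, hz⟩ := exists_eq_mul_of_mul_eq_mul h3 (by omega)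
    refine not_noPeriodicity_mul_suffix hγ hy hz ?_ (NoPeriodicity.of_mul_right (b := w) ?_)
    · rintro rfl
      simp at hlw
    · rwa [mul_assoc]

/-- The leading words in a solution of the equation `u₁ x u₂ x u₃ = v₁ x v₂ x v₃`. -/
lemma exists_isLeading_of_equation (hu₁ : IsLeading u₁ U₁) (hu₂ : IsLeading u₂ U₂)
    (hu₃ : IsLeading u₃ U₃) (hv₁ : IsLeading v₁ V₁) (hv₂ : IsLeading v₂ V₂)
    (hv₃ : IsLeading v₃ V₃) (h₁ : U₁.length = V₁.length) (h₂ : V₂.length < U₂.length)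
    (hx : x ≠ 0) (heq : u₁ * x * u₂ * x * u₃ = v₁ * x * v₂ * x * v₃) :
    ∃ y β γ, IsLeading x y ∧ U₁ = V₁ ∧ U₂ = V₂ * β ∧ V₃ = γ * U₃ ∧ β * y = y * γ := by
  have key : ∀ q, IsLongest x q → ∃ p, IsLongest x p ∧ U₁ = V₁ ∧ U₂ * p * U₃ = V₂ * q * V₃ := by
    intro q hq
    have h := (((hv₁.1.mul hq).mul hv₂.1).mul hq).mul hv₃.1
    rw [← heq] at h
    obtain ⟨w₁, U₃', hw₁, hU₃', e⟩ := h.exists_of_mul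
    obtain ⟨w₂, p, hw₂, hp, rfl⟩ := hw₁.exists_of_mul
    obtain ⟨w₃, U₂', hw₃, hU₂', rfl⟩ := hw₂.exists_of_mul
    obtain ⟨U₁', p', hU₁', hp', rfl⟩ := hw₃.exists_of_mul
    rw [hu₁.2 _ hU₁', hu₂.2 _ hU₂', hu₃.2 _ hU₃'] at e
    simp only [mul_assoc] at e
    obtain ⟨e1, e2⟩ := eq_and_eq_of_mul_eq_mul e h₁.symm
    obtain ⟨-, e3⟩ := eq_and_eq_of_mul_eq_mul e2 (hq.length_eq hp')
    exact ⟨p, hp, e1.symm, by simpa only [mul_assoc] using e3.symm⟩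
  obtain ⟨y, hy⟩ := exists_isLongest hx
  obtain ⟨p₀, hp₀, hUV, e₀⟩ := key y hy
  have hp₀y := hp₀.length_eq hy
  obtain ⟨β, hβ, e₁⟩ := exists_eq_mul_of_mul_eq_mul (a := V₂) (b := y * V₃) (c := U₂)
    (d := p₀ * U₃) (by rw [← mul_assoc, ← mul_assoc, e₀]) h₂.le
  rw [← mul_assoc] at e₁
  have hβ1 : 0 < β.length := by
    rw [hβ, FreeMonoid.length_mul] at h₂
    omega
  obtain ⟨γ, -, hγ⟩ := exists_eq_mul_of_mul_eq_mul e₁ (by rw [FreeMonoid.length_mul]; omega)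
  have step : ∀ q, IsLongest x q → ∃ p, IsLongest x p ∧ β * p = q * γ := by
    intro q hq
    obtain ⟨p, hp, -, e⟩ := key q hq
    refine ⟨p, hp, ?_⟩
    rw [hβ, hγ] at e
    simp only [mul_assoc, mul_right_inj] at e
    simp only [← mul_assoc, mul_left_inj] at e
    exact e
  -- Since βp = qγ, a long prefix of q is β followed by a shorter prefix of another longest word p.
  -- By induction all longest words agree.
  have huniq : ∀ n, ∀ a b c d : FreeMonoid (Fin k), a.length = n → c.length = n →
      IsLongest x (a * b) → IsLongest x (c * d) → a = c := by
    intro n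
    induction n using Nat.strong_induction_on with
    | _ n ih =>
      intro a b c d ha hc hab hcd
      obtain ⟨p, hp, hp'⟩ := step _ hab
      obtain ⟨q, hq, hq'⟩ := step _ hcd
      rw [mul_assoc] at hp' hq'
      rcases le_or_gt n β.length with hl | hl
      · obtain ⟨e, he, -⟩ := exists_eq_mul_of_mul_eq_mul hp'.symm (by omega)
        obtain ⟨f, hf, -⟩ := exists_eq_mul_of_mul_eq_mul hq'.symm (by omega)
        exact (eq_and_eq_of_mul_eq_mul (he.symm.trans hf) (by omega)).1
      · obtain ⟨a', rfl, rfl⟩ := exists_eq_mul_of_mul_eq_mul hp' (by omega)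
        obtain ⟨c', rfl, rfl⟩ := exists_eq_mul_of_mul_eq_mul hq' (by omega)
        rw [FreeMonoid.length_mul] at ha hc
        rw [ih a'.length (by omega) a' _ c' _ rfl (by omega) hp hq]
  have hlead : IsLeading x y := ⟨hy, fun w hw =>
    huniq y.length w 1 y 1 (hw.length_eq hy) rfl (by simpa using hw) (by simpa using hy)⟩
  obtain ⟨p, hp, e⟩ := step y hy
  rw [hlead.2 p hp] at e
  exact ⟨y, β, γ, hlead, hUV, hβ, hγ, e⟩

/-- If `s x = x t` and `s' x = x t'`, where `s` and `s'` have the same leading word, which is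
square-free and a period of the leading word of `x`, then `s` and `s'` differ by a constant. -/
lemma eq_or_eq_add_one_of_mul_eq_mul {s t s' t' : WordAlgebra k} (hx : IsLeading x y)
    (hs : IsLeading s β) (hs' : IsLeading s' β) (hy : β * y = y * γ) (hsq : NoPeriodicity β)
    (hl : 2 * β.length ≤ y.length) (h : s * x = x * t) (h' : s' * x = x * t') :
    (s' = s ∧ t' = t) ∨ (s' = s + 1 ∧ t' = t + 1) := by
  have hx0 := hx.ne_zero
  have hcomm : (s + s') * x = x * (t + t') := by rw [add_mul, mul_add, h, h']
  -- A non-empty m would be a period of y shorter than β. It would commute with β and be a prefix of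
  -- it, hence square-free and equal to β.
  have hword : ∀ m, IsLongest (s + s') m → m = 1 := by
    intro m hm
    by_contra hm1
    have hlt := hs.length_lt_of_add hs' hm.1
    have h1 := hm.mul hx.1
    rw [hcomm] at h1
    obtain ⟨y', b, hy', -, h2⟩ := h1.exists_of_mul
    rw [hx.2 y' hy'] at h2
    have h3 := mul_comm_of_periods (a := m) (c := 1) (by rwa [mul_one]) hy (by omega)
    obtain ⟨e, he, -⟩ := exists_eq_mul_of_mul_eq_mul h3 hlt.le
    have h4 := eq_of_mul_comm_of_noPeriodicity h3 hm1 (by rintro rfl; simp at hlt)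
      (NoPeriodicity.of_mul_right (b := e) (he ▸ hsq)) hsq
    rw [h4] at hlt
    exact lt_irrefl _ hlt
  have hconst : s + s' = 0 ∨ s + s' = 1 := by
    by_cases h0 : s + s' = 0
    · exact Or.inl h0
    right
    obtain ⟨m, hm⟩ := exists_isLongest h0
    obtain rfl := hword m hm
    ext w
    by_cases hw : w = 1
    · rw [hw, MonoidAlgebra.coeff_one_one, coeff_eq_one_of_ne_zero hm.1]
    · rw [MonoidAlgebra.one_def, MonoidAlgebra.coeff_single, Finsupp.single_eq_of_ne hw]
      by_contra h
      have := hm.2 w h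
      exact hw (FreeMonoid.length_eq_zero.1 (by simpa using this))
  have hs'_eq : s' = s + (s + s') := by rw [← add_assoc, CharTwo.add_self_eq_zero, zero_add]
  rcases hconst with h0 | h0 <;> rw [h0] at hs'_eq
  · rw [add_zero] at hs'_eq
    subst hs'_eq
    exact Or.inl ⟨rfl, mul_left_cancel₀ hx0 (h'.symm.trans h)⟩
  · subst hs'_eq
    refine Or.inr ⟨rfl, mul_left_cancel₀ hx0 (h'.symm.trans ?_)⟩
    rw [add_mul, mul_add, h, one_mul, mul_one]

/-- A solution of the equation commutes with the coefficients of a factorization. -/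
lemma mul_eq_mul_of_equation {s t s₂ t₂ μ₁ μ₂ : WordAlgebra k} (hμ₁ : μ₁ ≠ 0) (hu₃ : u₃ ≠ 0)
    (hv₂ : v₂ ≠ 0) (hμ₂ : v₂ * s₂ = t * μ₂)
    (hst : (s₂ = s ∧ t₂ = t) ∨ (s₂ = s + 1 ∧ t₂ = t + 1))
    (hs : IsLongest (s + 1) β) (hs₂ : IsLongest s₂ β) (ht : ∀ w, IsLongest t w → w ≠ 1)
    (heq : μ₁ * s * x * ((t + 1) * μ₂) * x * u₃ = μ₁ * (s + 1) * x * v₂ * x * (t₂ * u₃)) :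
    s * x = x * t := by
  by_cases hx : x = 0
  · simp [hx]
  by_contra hne
  -- The defect z is the same for the pairs (s, t) and (s₂, t₂).
  obtain ⟨z, hz⟩ : ∃ z, z = x * t - s * x := ⟨_, rfl⟩
  have hz0 : z ≠ 0 := by
    rw [hz, sub_ne_zero]
    exact Ne.symm hne
  have hxt : x * t = s * x + z := by rw [hz]; abel
  have hxt₂ : x * t₂ = s₂ * x + z := by
    rcases hst with ⟨rfl, rfl⟩ | ⟨rfl, rfl⟩
    · exact hxt
    · rw [mul_add, hxt, add_mul]
      simp only [mul_one, one_mul]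
      abel
  have h1 : s * x * ((t + 1) * μ₂) * x = (s + 1) * x * v₂ * x * t₂ := by
    refine mul_right_cancel₀ hu₃ (mul_left_cancel₀ hμ₁ ?_)
    simpa only [mul_assoc] using heq
  have h2 : s * x * ((t + 1) * μ₂) * x = s * (s * x + z + x) * μ₂ * x := by
    rw [← hxt]
    noncomm_ring
  have h3 : (s + 1) * x * v₂ * x * t₂
      = (s + 1) * (s * x + z) * μ₂ * x + (s + 1) * x * v₂ * z := by
    calc (s + 1) * x * v₂ * x * t₂ = (s + 1) * x * v₂ * (x * t₂) := by simp only [mul_assoc]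
      _ = (s + 1) * x * (v₂ * s₂) * x + (s + 1) * x * v₂ * z := by
        rw [hxt₂, mul_add]
        simp only [mul_assoc]
      _ = _ := by
        rw [hμ₂, ← hxt]
        simp only [mul_assoc]
  have h4 : z * μ₂ * x = (s + 1) * x * v₂ * z := by
    have h5 : s * (s * x + z + x) * μ₂ * x
        = (s + 1) * (s * x + z) * μ₂ * x - z * μ₂ * x := by noncomm_ring
    rw [h2, h3, h5, sub_eq_add_neg, add_right_inj, CharTwo.neg_eq] at h1
    exact h1
  have hμ₂0 : t * μ₂ ≠ 0 := hμ₂ ▸ mul_ne_zero hv₂ hs₂.ne_zero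
  obtain ⟨X, hX⟩ := exists_isLongest hx
  obtain ⟨Z, hZ⟩ := exists_isLongest hz0
  obtain ⟨V, hV⟩ := exists_isLongest hv₂
  obtain ⟨T, hT⟩ := exists_isLongest (left_ne_zero_of_mul hμ₂0)
  obtain ⟨M, hM⟩ := exists_isLongest (right_ne_zero_of_mul hμ₂0)
  -- `h4` gives |M| = |β| + |V| and `hμ₂` gives |V| + |β| = |T| + |M|, so |T| = 0.
  have l1 := ((hZ.mul hM).mul hX).length_eq (h4 ▸ ((hs.mul hX).mul hV).mul hZ)
  have l2 := (hV.mul hs₂).length_eq (hμ₂ ▸ hT.mul hM)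
  simp only [FreeMonoid.length_mul] at l1 l2
  have := length_pos_of_ne_one (ht T hT)
  omega

/-! ### The factorization -/

/-- The factorization of the coefficients of an equation that has a long solution. -/
theorem exists_factorization (hne : u₁ ≠ v₁) (hu₁ : IsLeading u₁ U₁) (hu₂ : IsLeading u₂ U₂)
    (hu₃ : IsLeading u₃ U₃) (hv₁ : IsLeading v₁ V₁) (hv₂ : IsLeading v₂ V₂)
    (hv₃ : IsLeading v₃ V₃) (h₁ : U₁.length = V₁.length) (h₂ : V₂.length < U₂.length)
    (h₃ : U₃.length < V₃.length) (hsqU₂ : NoPeriodicity U₂) (hsqV₁ : NoPeriodicity V₁)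
    (hsqV₃ : NoPeriodicity V₃) (heq : u₁ * x * u₂ * x * u₃ = v₁ * x * v₂ * x * v₃)
    (hl : ∃ m, x.coeff m ≠ 0 ∧ 2 * (U₁.length + U₂.length) < m.length ∧
      U₃.length ≤ m.length) :
    ∃ s t μ₁ μ₂ s₂ t₂ : WordAlgebra k, u₁ = μ₁ * s ∧ v₁ = μ₁ * (s + 1) ∧
      u₂ = (t + 1) * μ₂ ∧ v₂ * s₂ = t * μ₂ ∧ v₃ = t₂ * u₃ ∧
      ((s₂ = s ∧ t₂ = t) ∨ (s₂ = s + 1 ∧ t₂ = t + 1)) ∧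
      (∃ β, IsLongest (s + 1) β ∧ IsLongest s₂ β) ∧ ∀ w, IsLongest t w → w ≠ 1 := by
  obtain ⟨m, hm, hl₁₂, hl₃⟩ := hl
  have hx0 : x ≠ 0 := by
    rintro rfl
    exact hm (by simp)
  obtain ⟨y, β, γ, hx, rfl, rfl, rfl, hy⟩ :=
    exists_isLeading_of_equation hu₁ hu₂ hu₃ hv₁ hv₂ hv₃ h₁ h₂ hx0 heq
  have hmy := hx.1.2 m hm
  simp only [FreeMonoid.length_mul] at h₂ h₃ hl₁₂
  have hβ : β ≠ 1 := by rintro rfl; simp at h₂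
  have hγ : γ ≠ 1 := by rintro rfl; simp at h₃
  have hsqβ : NoPeriodicity β := hsqU₂.of_mul_left
  have hr0 : u₁ + v₁ ≠ 0 := by rwa [Ne, CharTwo.add_eq_zero]
  have hC : v₁ * (x * (u₂ * x * u₃ + v₂ * x * v₃)) = (u₁ + v₁) * (x * u₂ * x * u₃) := by
    calc _ = v₁ * x * u₂ * x * u₃ + v₁ * x * v₂ * x * v₃ := by noncomm_ring
      _ = v₁ * x * u₂ * x * u₃ + u₁ * x * u₂ * x * u₃ := by rw [heq]
      _ = _ := by noncomm_ring
  have hC0 : u₂ * x * u₃ + v₂ * x * v₃ ≠ 0 := by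
    intro h0
    rw [h0, mul_zero, mul_zero] at hC
    exact mul_ne_zero hr0 (mul_ne_zero (mul_ne_zero (mul_ne_zero hx0 hu₂.ne_zero) hx0)
      hu₃.ne_zero) hC.symm
  obtain ⟨c, hc⟩ := exists_isLongest hC0
  -- Top words in `hC` give U₁ = Rσ with σ a period of y, and then σ = β.
  have hR : ∀ R, IsLongest (u₁ + v₁) R → U₁ = R * β := by
    intro R hR
    have hlt := hu₁.length_lt_of_add hv₁ hR.1
    have h4 := hR.mul (((hx.1.mul hu₂.1).mul hx.1).mul hu₃.1)
    rw [← hC] at h4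
    have h5 := (hv₁.mul hx).1.mul hc
    obtain ⟨V, d, hV, hd, h6⟩ := h4.exists_of_mul
    obtain ⟨y', c', hy', -, rfl⟩ := hd.exists_of_mul
    rw [hv₁.2 V hV, hx.2 y' hy'] at h6
    obtain ⟨σ, hσ, h7⟩ := exists_eq_mul_of_mul_eq_mul h6 hlt.le
    have hlen := congrArg FreeMonoid.length hσ
    rw [FreeMonoid.length_mul] at hlen
    have h8 := mul_comm_of_periods (a := σ) (b := β) (y := y) (c := c')
      (by simpa only [mul_assoc] using h7.symm) hy (by omega)
    rw [hσ, eq_of_mul_comm_of_noPeriodicity h8 (by rintro rfl; simp at hlen; omega) hβ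
      (NoPeriodicity.of_mul_left (a := R) (hσ ▸ hsqV₁)) hsqβ]
  obtain ⟨R, hR1⟩ := exists_isLongest hr0
  have hr : IsLeading (u₁ + v₁) R := ⟨hR1, fun w hw =>
    mul_right_cancel ((hR w hw).symm.trans (hR R hR1))⟩
  obtain rfl := hR R hR1
  rw [FreeMonoid.length_mul] at hl₁₂
  obtain ⟨q, hq⟩ := exists_eq_mul_left_of_noPeriodicity hr hx hsqV₁ hβ hy (by omega) hC0 hC
  have hqβ : IsLeading q β := by
    have : ∀ w, IsLongest q w → w = β := fun w hw =>
      mul_left_cancel (hv₁.2 _ (by rw [hq]; exact hR1.mul hw))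
    obtain ⟨w, hw⟩ := exists_isLongest (right_ne_zero_of_mul (hq ▸ hv₁.ne_zero))
    exact ⟨this w hw ▸ hw, this⟩
  obtain ⟨t₂, ht₂⟩ := exists_eq_mul_right_of_noPeriodicity (v := v₃) (h := u₁ * x * u₂ * x)
    (g := v₁ * x * v₂) hu₃ hx hsqV₃ hγ hy (by omega)
    (mul_ne_zero (mul_ne_zero hv₁.ne_zero hx0) hv₂.ne_zero) heq.symm
  have ht₂γ : IsLeading t₂ γ := by
    have : ∀ w, IsLongest t₂ w → w = γ := fun w hw =>
      mul_right_cancel (hv₃.2 _ (by rw [ht₂]; exact hw.mul hu₃.1))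
    obtain ⟨w, hw⟩ := exists_isLongest (left_ne_zero_of_mul (ht₂ ▸ hv₃.ne_zero))
    exact ⟨this w hw ▸ hw, this⟩
  have hD : q * x * (u₂ * x + v₂ * x * t₂) = x * u₂ * x := by
    refine mul_right_cancel₀ hu₃.ne_zero (mul_left_cancel₀ hr0 ?_)
    calc (u₁ + v₁) * (q * x * (u₂ * x + v₂ * x * t₂) * u₃)
        = (u₁ + v₁) * q * (x * (u₂ * x * u₃ + v₂ * x * (t₂ * u₃))) := by noncomm_ring
      _ = (u₁ + v₁) * (x * u₂ * x * u₃) := by rw [← hq, ← ht₂, hC]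
  -- After specialization x commutes with t₂, so it divides both summands.
  obtain ⟨E, hE⟩ := exists_eq_mul_right_of_mul_eq_mul hx (mul_ne_zero hqβ.ne_zero hx0) hD
    (by simp only [map_add, map_mul]; exact ⟨specialize u₂ + specialize v₂ * specialize t₂, by ring⟩)
  have hE' : q * x * E = x * u₂ :=
    mul_right_cancel₀ hx0 (by rw [mul_assoc, ← hE, hD])
  have hE0 : E ≠ 0 := right_ne_zero_of_mul (hE' ▸ mul_ne_zero hx0 hu₂.ne_zero)
  obtain ⟨p, hp⟩ := exists_eq_mul_left_of_mul_eq_mul hx hE0 hE' (by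
    rw [map_mul]; exact dvd_mul_left _ _)
  have hu₂E : p * E = u₂ := mul_left_cancel₀ hx0 (by rw [← mul_assoc, ← hp, hE'])
  have hv₂E : v₂ * (x * t₂) = (E + u₂) * x := by
    rw [add_mul, ← hE, ← mul_assoc, add_right_comm, CharTwo.add_self_eq_zero, zero_add]
  obtain ⟨s₂, hs₂⟩ := exists_eq_mul_right_of_mul_eq_mul hx hv₂.ne_zero hv₂E (by
    rw [map_mul]; exact dvd_mul_right _ _)
  have hs₂β : IsLeading s₂ β := by
    have : ∀ w, IsLongest s₂ w → w = β := by
      intro w hw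
      have h4 := hw.mul hx.1
      rw [← hs₂] at h4
      have h5 := (hx.mul ht₂γ).2 _ h4
      rw [← hy] at h5
      exact mul_right_cancel h5
    obtain ⟨w, hw⟩ := exists_isLongest (left_ne_zero_of_mul (hs₂ ▸ mul_ne_zero hx0 ht₂γ.ne_zero))
    exact ⟨this w hw ▸ hw, this⟩
  have hpp : p + 1 + 1 = p := by rw [add_assoc, CharTwo.add_self_eq_zero, add_zero]
  have hqq : q + 1 + 1 = q := by rw [add_assoc, CharTwo.add_self_eq_zero, add_zero]
  have hst := eq_or_eq_add_one_of_mul_eq_mul hx hqβ hs₂β hy hsqβ (by omega) hp hs₂.symm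
  -- The shift by 1 matches v₁ = μ₁(s + 1) and u₂ = (t + 1)μ₂, since 1 + 1 = 0.
  refine ⟨q + 1, p + 1, u₁ + v₁, E, s₂, t₂, ?_, ?_, ?_, ?_, ht₂, ?_, ⟨β, ?_, hs₂β.1⟩, ?_⟩
  · rw [mul_add, ← hq, mul_one, add_comm u₁, ← add_assoc, CharTwo.add_self_eq_zero, zero_add]
  · rw [hqq]
    exact hq
  · rw [hpp, hu₂E]
  · refine mul_right_cancel₀ hx0 ?_
    rw [mul_assoc, ← hs₂, hv₂E, add_mul p, hu₂E, one_mul, add_comm]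
  · rw [hpp, hqq]
    exact hst.symm
  · rw [hqq]
    exact hqβ.1
  · have hpγ : ∀ w, IsLongest p w → w = γ := by
      intro w hw
      have h4 := hx.1.mul hw
      rw [← hp] at h4
      have h5 := (hqβ.mul hx).2 _ h4
      rw [hy] at h5
      exact mul_left_cancel h5
    obtain ⟨w, hw⟩ := exists_isLongest (left_ne_zero_of_mul (hu₂E ▸ hu₂.ne_zero))
    obtain rfl := hpγ w hw
    intro v hv hv1
    have := hv.length_eq (hw.add_one hγ)
    rw [hv1] at this
    exact hγ (FreeMonoid.length_eq_zero.1 (by simpa using this.symm))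

end Algebra

/-! ### Transfer to the free algebra -/

lemma IsTopMonomial.isLeading {f : FA k} {m : FreeMonoid (Fin k)} (h : IsTopMonomial f m) :
    IsLeading (FreeAlgebra.equivMonoidAlgebraFreeMonoid f) m := by
  have hmem : ∀ w, w ∈ monomials f ↔
      (FreeAlgebra.equivMonoidAlgebraFreeMonoid f).coeff w ≠ 0 := fun w =>
    Finsupp.mem_support_iff
  refine ⟨⟨(hmem m).1 h.1, fun w hw => ?_⟩, fun w hw => ?_⟩
  · by_cases hwm : w = m
    · rw [hwm]
    · exact (h.2 w ((hmem w).2 hw) hwm).le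
  · by_contra hwm
    have h1 := h.2 w ((hmem w).2 hw.1) hwm
    have h2 := hw.2 m ((hmem m).1 h.1)
    exact absurd h1 (not_lt.2 h2)

lemma IsTopMonomial.deg_eq {f : FA k} {m : FreeMonoid (Fin k)} (h : IsTopMonomial f m) :
    deg f = m.length := by
  refine le_antisymm (Finset.sup_le fun w hw => ?_)
    (Finset.le_sup (f := fun m : FreeMonoid (Fin k) => m.toList.length) h.1)
  by_cases hwm : w = m
  · rw [hwm]; rfl
  · exact (h.2 w hw hwm).le

/-- Positivity excludes f = 0, whose degree 0 is only a convention. -/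
lemma exists_length_eq_deg {f : FA k} (h : 0 < deg f) :
    ∃ m, (FreeAlgebra.equivMonoidAlgebraFreeMonoid f).coeff m ≠ 0 ∧ m.length = deg f := by
  have hne : (monomials f).Nonempty := by
    rw [Finset.nonempty_iff_ne_empty]
    intro h0
    rw [deg, h0, Finset.sup_empty] at h
    exact lt_irrefl _ h
  obtain ⟨m, hm, hm'⟩ := Finset.exists_mem_eq_sup _ hne
    (fun m : FreeMonoid (Fin k) => m.toList.length)
  exact ⟨m, Finsupp.mem_support_iff.1 hm, hm'.symm⟩

end MonomialEq

theorem lemma4p13 {k : ℕ} (u₁ u₂ u₃ v₁ v₂ v₃ : MonomialEq.FA k)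
    (hne : u₁ ≠ v₁)
    (hdeg₁ : MonomialEq.deg u₁ = MonomialEq.deg v₁)
    (hdeg₂ : MonomialEq.deg v₂ < MonomialEq.deg u₂)
    (hdeg₃ : MonomialEq.deg u₃ < MonomialEq.deg v₃)
    (hu₁ : MonomialEq.AperiodicTop u₁) (hu₂ : MonomialEq.AperiodicTop u₂)
    (hu₃ : MonomialEq.AperiodicTop u₃) (hv₁ : MonomialEq.AperiodicTop v₁)
    (hv₂ : MonomialEq.AperiodicTop v₂) (hv₃ : MonomialEq.AperiodicTop v₃)
    (x₁ : MonomialEq.FA k)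
    (hx₁ : u₁ * x₁ * u₂ * x₁ * u₃ = v₁ * x₁ * v₂ * x₁ * v₃)
    (hper : ∀ w y : FreeMonoid (Fin k),
      MonomialEq.IsTopMonomial (u₁ * x₁ * u₂ * x₁ * u₃) w → MonomialEq.IsTopMonomial x₁ y →
      MonomialEq.PeriodicityContainedIn w y)
    (hlong : 2 * (MonomialEq.deg u₁ + MonomialEq.deg u₂ + MonomialEq.deg u₃ ^ 2)
      < MonomialEq.deg x₁) :
    ∃ s t : MonomialEq.FA k,
      ((∃ μ₁ μ₂ s₂ t₂ : MonomialEq.FA k,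
          u₁ = μ₁ * (s + 1) ∧ v₁ = μ₁ * s ∧
          v₂ = (t + 1) * μ₂ ∧ u₂ = t * μ₂ * s₂ ∧ v₃ = t₂ * u₃ ∧
          ((s₂ = s ∧ t₂ = t) ∨ (s₂ = s + 1 ∧ t₂ = t + 1))) ∨
        (∃ μ₁ μ₂ s₂ t₂ : MonomialEq.FA k,
          u₁ = μ₁ * s ∧ v₁ = μ₁ * (s + 1) ∧
          u₂ = (t + 1) * μ₂ ∧ v₂ * s₂ = t * μ₂ ∧ v₃ = t₂ * u₃ ∧
          ((s₂ = s ∧ t₂ = t) ∨ (s₂ = s + 1 ∧ t₂ = t + 1)))) ∧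
      (∀ x : MonomialEq.FA k, s * x = x * t →
        u₁ * x * u₂ * x * u₃ = v₁ * x * v₂ * x * v₃) ∧
      (∀ x₂ : MonomialEq.FA k, u₁ * x₂ * u₂ * x₂ * u₃ = v₁ * x₂ * v₂ * x₂ * v₃ →
        2 * (2 + 2 ^ (MonomialEq.deg s + 2)
          + MonomialEq.deg u₁ + MonomialEq.deg u₂ + MonomialEq.deg u₃) < MonomialEq.deg x₂ →
        s * x₂ = x₂ * t) := by
  obtain ⟨U₁, hU₁, -⟩ := hu₁
  obtain ⟨U₂, hU₂, hsqU₂⟩ := hu₂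
  obtain ⟨U₃, hU₃, -⟩ := hu₃
  obtain ⟨V₁, hV₁, hsqV₁⟩ := hv₁
  obtain ⟨V₂, hV₂, -⟩ := hv₂
  obtain ⟨V₃, hV₃, hsqV₃⟩ := hv₃
  obtain ⟨m, hm, hmdeg⟩ := MonomialEq.exists_length_eq_deg (by omega : 0 < MonomialEq.deg x₁)
  rw [← hmdeg] at hlong
  rw [hU₁.deg_eq, hV₁.deg_eq] at hdeg₁
  rw [hU₂.deg_eq, hV₂.deg_eq] at hdeg₂
  rw [hU₃.deg_eq, hV₃.deg_eq] at hdeg₃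
  rw [hU₁.deg_eq, hU₂.deg_eq, hU₃.deg_eq] at hlong
  -- Only deg u₃ ≤ (deg u₃)² is needed, to get |U₃| ≤ |y|.
  have hpow := Nat.le_self_pow two_ne_zero U₃.length
  set e := FreeAlgebra.equivMonoidAlgebraFreeMonoid (R := ZMod 2) (X := Fin k)
  obtain ⟨s, t, μ₁, μ₂, s₂, t₂, h1, h2, h3, h4, h5, hst, ⟨β, hβ, hβ'⟩, ht⟩ :=
    MonomialEq.exists_factorization (x := e x₁) (fun h => hne (e.injective h)) hU₁.isLeading
      hU₂.isLeading hU₃.isLeading hV₁.isLeading hV₂.isLeading hV₃.isLeading hdeg₁ hdeg₂ hdeg₃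
      hsqU₂ hsqV₁ hsqV₃ (by simpa only [map_mul] using congrArg e hx₁)
      ⟨m, hm, by omega, by omega⟩
  have hμ₁ : μ₁ ≠ 0 := left_ne_zero_of_mul (h1 ▸ hU₁.isLeading.ne_zero)
  have hst' : (e.symm s₂ = e.symm s ∧ e.symm t₂ = e.symm t) ∨
      (e.symm s₂ = e.symm s + 1 ∧ e.symm t₂ = e.symm t + 1) := by
    rcases hst with ⟨rfl, rfl⟩ | ⟨rfl, rfl⟩
    · exact Or.inl ⟨rfl, rfl⟩
    · exact Or.inr ⟨by simp, by simp⟩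
  have e1 : u₁ = e.symm μ₁ * e.symm s := e.injective (by simpa using h1)
  have e2 : v₁ = e.symm μ₁ * (e.symm s + 1) := e.injective (by simpa using h2)
  have e3 : u₂ = (e.symm t + 1) * e.symm μ₂ := e.injective (by simpa using h3)
  have e4 : v₂ * e.symm s₂ = e.symm t * e.symm μ₂ := e.injective (by simpa using h4)
  have e5 : v₃ = e.symm t₂ * u₃ := e.injective (by simpa using h5)
  refine ⟨e.symm s, e.symm t, Or.inr ⟨e.symm μ₁, e.symm μ₂, e.symm s₂, e.symm t₂, e1, e2, e3, e4,
    e5, hst'⟩, fun x hx => ?_, fun x hx _ => e.injective ?_⟩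
  -- Adding 1 to both s and t preserves the relation sx = xt.
  · have hx' : x * e.symm t₂ = e.symm s₂ * x := by
      rcases hst' with ⟨h, h'⟩ | ⟨h, h'⟩
      · rw [h, h', hx]
      · rw [h, h', mul_add, add_mul, hx, mul_one, one_mul]
    calc u₁ * x * u₂ * x * u₃
        = e.symm μ₁ * (e.symm s * x) * (e.symm t + 1) * e.symm μ₂ * x * u₃ := by
          rw [e1, e3]; simp only [mul_assoc]
      _ = e.symm μ₁ * (x * e.symm t + x) * (e.symm t * e.symm μ₂) * x * u₃ := by
          rw [hx]; noncomm_ring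
      _ = e.symm μ₁ * (e.symm s + 1) * x * v₂ * (e.symm s₂ * x) * u₃ := by
          rw [← e4, ← hx]; noncomm_ring
      _ = v₁ * x * v₂ * x * v₃ := by
          rw [← hx', e2, e5]; simp only [mul_assoc]
  · have hx' := congrArg e hx
    simp only [map_mul] at hx'
    rw [h1, h2, h3, h5] at hx'
    simpa using MonomialEq.mul_eq_mul_of_equation hμ₁ hU₃.isLeading.ne_zero hV₂.isLeading.ne_zero
      h4 hst hβ hβ' ht hx'
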